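/- **Conventions.** A frame $L$ is a complete lattice in which finite meets distribute over arbitrary joins; $\neg a$ is the pseudo-complement of $a$, and $a\prec b$ means $b\vee\neg a=1$. $L$ is a *compact regular frame* if $1=\bigvee B$ implies $1=\bigvee B'$ for some finite $B'\subseteq B$, and $a=\bigvee\{b\mid b\prec a\}$ for every $a\in L$. $\mathbf{KRFrm}$ is the category of compact regular frames and maps preserving finite meets and arbitrary joins. For a topological space $X$, write $x\le y$ if every open set containing $x$ contains $y$; for $U\subseteq X$ let ${\downarrow}U=\{x\mid \exists y\in U,\ x\le y\}$, $\Box U=\{x\mid \forall y\ge x,\ y\in U\}$ and $U^{\bot}=X\setminus\overline U$. $U$ is *regular open* ($U\in\mathsf{RO}(X)$) if $U^{\bot\bot}=U$, and *order-regular open* if $\Box{\downarrow}U=U$; $B$ is *regular closed* if it is the closure of its interior. For $U,V\in\mathsf{RO}(X)$ put $U\ll V$ iff $\overline U\subseteq{\downarrow}V$. For a proper filter $F$ of the Boolean algebra $\mathsf{RO}(X)$ let $F^{\circ}=\{V\in F\mid \exists U\in F,\ U\ll V\}$; $F$ is *concordant* if $F^{\circ}=F$. $X$ is a *$dV$-space*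 if: 1. $X$ is $T_0$, compact and order-normal, i.e. whenever $A$ is closed, $B$ is regular closed and $A\cap\Box B=\emptyset$, there are disjoint open sets $U,V$ with $A\subseteq{\downarrow}U$ and $\Box B\subseteq V$; 2. $\mathsf{RO}(X)$ is a basis of the topology, and every regular open set is order-regular open; 3. for every $x\in X$, $\mathsf{RO}(x)=\{U\in\mathsf{RO}(X)\mid x\in U\}$ is a concordant filter, and for every proper filter $F$ on $\mathsf{RO}(X)$ there is $x\in X$ with $F^{\circ}=\mathsf{RO}(x)$. A *$dV$-map* $f:X\to Y$ between $dV$-spaces is a continuous map such that whenever $f(x)\le y$ there is $x'\ge x$ with $y\le f(x')$. $\mathbf{dVS}$ is the category of $dV$-spaces and $dV$-maps. An open set $U$ is *well-rounded* if for every closed $B\subseteq{\downarrow}U$ there are disjoint open $V,W$ with $B\subseteq{\downarrow}V$ and $X\setminus W\subseteq{\downarrow}U$. Let $\mathcal W(X)$ be the set of well-rounded order-regular open subsets of $X$, ordered by inclusion. For a compact regular frame $L$ let $\Xi(L)$ be the set $L\setminus\{1\}$ with the topology generated by the sets $\{b\mid \neg a\prec b\}$, $a\in L$. **Theorem.** -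 For every compact regular frame $L$, $\Xi(L)$ is a $dV$-space, and $L$ is isomorphic to $\mathcal W(\Xi(L))$. - For every $dV$-space $X$, $\mathcal W(X)$ is a compact regular frame, and $X$ is homeomorphic to $\Xi(\mathcal W(X))$. - Every $dV$-map $f:X\to Y$ induces a frame homomorphism $\mathcal W(f):\mathcal W(Y)\to\mathcal W(X)$, $U\mapsto f^{-1}[U]$, and every frame homomorphism $h:L\to M$ between compact regular frames induces a $dV$-map $\Xi(h):\Xi(M)\to\Xi(L)$, $b\mapsto\bigvee\{a\in L\mid h(a)\le b\}$. The resulting contravariant functors $\mathcal W:\mathbf{dVS}\to\mathbf{KRFrm}$ and $\Xi:\mathbf{KRFrm}\to\mathbf{dVS}$ form a dual equivalence of categories. -/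

import Mathlib

universe u

namespace DeVries

open CategoryTheory

section Topology

variable {X : Type u} [TopologicalSpace X]

/-- The specialization preorder: `x ≤ y` iff every open set containing `x` contains `y`. -/
def SpecLE (x y : X) : Prop := ∀ U : Set X, IsOpen U → x ∈ U → y ∈ U

/-- `↓U`, the closure of `U` in the topology of all sets that are upward closed in the
specialization preorder, i.e. the downward closure of `U`. -/
def down (U : Set X) : Set X := {x | ∃ y ∈ U, SpecLE x y}

/-- The interior of `U` in the topology of all sets that are upward closed in the
specialization preorder. -/
def upInterior (U : Set X) : Set X := {x | ∀ y, SpecLE x y → y ∈ U}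

/-- `U⊥`, the complement of the closure of `U`. -/
def perp (U : Set X) : Set X := (closure U)ᶜ

/-- Membership in `RO(X)`: `U⊥⊥ = U`. -/
def IsRegularOpen (U : Set X) : Prop := perp (perp U) = U

/-- Regular closed sets: closures of their interior. -/
def IsRegularClosed (B : Set X) : Prop := closure (interior B) = B

/-- Regular open sets of the topology of upward closed sets. -/
def IsOrderRegularOpen (U : Set X) : Prop := upInterior (down U) = U

/-- `U ≪ V` iff the closure of `U` is contained in `↓V`. -/
def WayInside (U V : Set X) : Prop := closure U ⊆ down V

/-- An open set `U` is well-rounded if for every closed `B ⊆ ↓U` there are disjoint open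
`V`, `W` with `B ⊆ ↓V` and `-W ⊆ ↓U`. -/
structure IsWellRounded (U : Set X) : Prop where
  isOpen : IsOpen U
  separation : ∀ B : Set X, IsClosed B → B ⊆ down U →
    ∃ V W : Set X, IsOpen V ∧ IsOpen W ∧ Disjoint V W ∧ B ⊆ down V ∧ Wᶜ ⊆ down U

/-- (Proper) filters on the Boolean algebra `RO(X)`, whose order is inclusion, whose binary meet
is intersection, whose top is `X` and whose bottom is `∅`. -/
structure IsROFilter (F : Set (Set X)) : Prop where
  regular : ∀ U ∈ F, IsRegularOpen U
  univ_mem : Set.univ ∈ F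
  inter_mem : ∀ U ∈ F, ∀ V ∈ F, U ∩ V ∈ F
  mem_of_subset : ∀ U ∈ F, ∀ V, IsRegularOpen V → U ⊆ V → V ∈ F
  empty_notMem : ∅ ∉ F

/-- The round part of a family `F` of sets: those `V ∈ F` such that `U ≪ V` for some `U ∈ F`. -/
def roundPart (F : Set (Set X)) : Set (Set X) := {V ∈ F | ∃ U ∈ F, WayInside U V}

/-- Concordant filters on `(RO(X), ≪)`. -/
structure IsConcordant (F : Set (Set X)) : Prop where
  isROFilter : IsROFilter F
  roundPart_eq : roundPart F = F

/-- `RO(x)`, the set of regular open sets that contain `x`. -/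
def regularNhds (x : X) : Set (Set X) := {U | IsRegularOpen U ∧ x ∈ U}

variable (X) in
/-- Order-normal spaces. -/
def IsOrderNormal : Prop :=
  ∀ A B : Set X, IsClosed A → IsRegularClosed B → Disjoint A (upInterior B) →
    ∃ U V : Set X, IsOpen U ∧ IsOpen V ∧ Disjoint U V ∧ A ⊆ down U ∧ upInterior B ⊆ V

variable (X) in
/-- De Vries spaces (`dV`-spaces). -/
structure IsDVSpace : Prop where
  t0 : T0Space X
  compact : CompactSpace X
  orderNormal : IsOrderNormal X
  basis : TopologicalSpace.IsTopologicalBasis {U : Set X | IsRegularOpen U}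
  orderRegular : ∀ U : Set X, IsRegularOpen U → IsOrderRegularOpen U
  concordant : ∀ x : X, IsConcordant (regularNhds x)
  exists_point : ∀ F : Set (Set X), IsROFilter F → ∃ x : X, roundPart F = regularNhds x

/-- `dV`-maps: continuous weakly dense maps. -/
structure IsDVMap {Y : Type u} [TopologicalSpace Y] (f : X → Y) : Prop where
  continuous : Continuous f
  weaklyDense : ∀ (x : X) (y : Y), SpecLE (f x) y → ∃ x' : X, SpecLE x x' ∧ SpecLE y (f x')

variable (X) in
/-- The poset, under inclusion, of well-rounded (open) sets that are order-regular open. -/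
abbrev WORO : Type u := {U : Set X // IsWellRounded U ∧ IsOrderRegularOpen U}

end Topology

section Maps

variable {X Y Z : Type u} [TopologicalSpace X] [TopologicalSpace Y] [TopologicalSpace Z]

theorem SpecLE.map {x y : X} (h : SpecLE x y) {f : X → Y} (hf : Continuous f) :
    SpecLE (f x) (f y) := fun U hU hx => h (f ⁻¹' U) (hU.preimage hf) hx

theorem IsDVMap.id : IsDVMap (id : X → X) :=
  ⟨continuous_id, fun _ y h => ⟨y, h, fun _ _ hy => hy⟩⟩

theorem IsDVMap.comp {g : Y → Z} {f : X → Y} (hg : IsDVMap g) (hf : IsDVMap f) :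
    IsDVMap (g ∘ f) where
  continuous := hg.continuous.comp hf.continuous
  weaklyDense x z h := by
    obtain ⟨y, hy, hz⟩ := hg.weaklyDense (f x) z h
    obtain ⟨x', hx, hy'⟩ := hf.weaklyDense x y hy
    exact ⟨x', hx, fun U hU hzU => (hy'.map hg.continuous) U hU (hz U hU hzU)⟩

end Maps

/-- A `dV`-space, bundled. -/
structure DVS : Type (u + 1) where
  carrier : Type u
  [top : TopologicalSpace carrier]
  isDVSpace : IsDVSpace carrier

instance : CoeSort DVS.{u} (Type u) := ⟨DVS.carrier⟩

attribute [instance] DVS.top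

/-- A morphism of `dV`-spaces is a `dV`-map. -/
@[ext]
structure DVS.Hom (X Y : DVS.{u}) : Type u where
  toFun : X → Y
  isDVMap : IsDVMap toFun

/-- The category of `dV`-spaces and `dV`-maps. -/
instance : Category DVS.{u} where
  Hom := DVS.Hom
  id X := ⟨id, IsDVMap.id⟩
  comp f g := ⟨g.toFun ∘ f.toFun, g.isDVMap.comp f.isDVMap⟩

section Frames

variable {L : Type u} [Order.Frame L]

/-- `a ≺ b` (`a` is rather below `b`): `b ∨ ¬a = 1`, where `¬a` is the pseudo-complement. -/
def RatherBelow (a b : L) : Prop := b ⊔ aᶜ = ⊤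

variable (L) in
/-- Compact regular frames. -/
structure IsCompactRegular : Prop where
  compact : ∀ S : Set L, sSup S = ⊤ → ∃ T : Finset L, (T : Set L) ⊆ S ∧ sSup (T : Set L) = ⊤
  regular : ∀ a : L, a = sSup {b | RatherBelow b a}

variable (L) in
/-- The set of points of `Ξ(L)`: all elements of `L` other than the top. -/
def Xi : Type u := {b : L // b ≠ ⊤}

/-- The topology of `Ξ(L)`, generated by the sets `{b | ¬a ≺ b}` for `a ∈ L`. -/
instance : TopologicalSpace (Xi L) :=
  TopologicalSpace.generateFrom {S | ∃ a : L, S = {b : Xi L | RatherBelow aᶜ b.1}}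

/-- The right adjoint of a frame homomorphism `h : L → M`, sending `b` to the largest `a` such
that `h a ≤ b`. -/
def rightAdjoint {M : Type u} [Order.Frame M] (h : FrameHom L M) (b : M) : L :=
  sSup {a | h a ≤ b}

theorem gc_rightAdjoint {M : Type u} [Order.Frame M] (h : FrameHom L M) :
    GaloisConnection h (rightAdjoint h) := by
  intro a b
  refine ⟨fun hab => le_sSup hab, fun hab => ?_⟩
  refine le_trans (OrderHomClass.mono h hab) ?_
  rw [rightAdjoint, map_sSup]
  exact sSup_le (by rintro _ ⟨c, hc, rfl⟩; exact hc)

/-- The action of `Ξ` on a frame homomorphism `h : L → M`: the right adjoint of `h`, restricted to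
a map `Ξ(M) → Ξ(L)`. -/
def Xi.map {M : Type u} [Order.Frame M] (h : FrameHom L M) (b : Xi M) : Xi L :=
  ⟨rightAdjoint h b.1, fun hb => b.2 (top_le_iff.mp
    ((map_top h).symm.le.trans ((gc_rightAdjoint h ⊤ b.1).mpr hb.ge)))⟩

end Frames

/-- The category of compact regular frames and frame homomorphisms. -/
abbrev KRFrm : Type (u + 1) :=
  ObjectProperty.FullSubcategory (fun L : Frm.{u} => IsCompactRegular L)

/-- The frame homomorphism underlying a morphism of `KRFrm`. -/
abbrev KRFrm.frameHom {L M : KRFrm.{u}} (h : L ⟶ M) : FrameHom L.obj M.obj := h.hom.hom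

/-- A partially ordered set is a compact regular frame if its order is that of a compact regular
frame (the other frame operations are then uniquely determined). -/
def IsCompactRegularFrameOrder (P : Type u) [PartialOrder P] : Prop :=
  ∃ F : Order.Frame P, (∀ a b : P, F.le a b ↔ a ≤ b) ∧ @IsCompactRegular P F

/-- The frame structure of a poset which is a compact regular frame, with the given order. -/
noncomputable abbrev IsCompactRegularFrameOrder.frame {P : Type u} [PartialOrder P]
    (h : IsCompactRegularFrameOrder P) : Order.Frame P :=
  @Frame.copy P h.choose (fun a b : P => a ≤ b)
    (funext fun a => funext fun b => propext (h.choose_spec.1 a b).symm)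
    _ rfl _ rfl _ rfl _ rfl _ rfl _ rfl _ rfl _ rfl

theorem IsCompactRegularFrameOrder.isCompactRegular {P : Type u} [PartialOrder P]
    (h : IsCompactRegularFrameOrder P) : @IsCompactRegular P h.frame := by
  have key : ∀ (F : Order.Frame P) (le : P → P → Prop) (e : le = F.le), @IsCompactRegular P F →
      @IsCompactRegular P (@Frame.copy P F le e
        _ rfl _ rfl _ rfl _ rfl _ rfl _ rfl _ rfl _ rfl) := by
    intro F le e hF
    subst e
    exact @IsCompactRegular.mk P (_) hF.compact hF.regular
  exact key _ _ _ h.choose_spec.2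

/-- The claim that `Ξ` lifts to a contravariant functor from compact regular frames to
`dV`-spaces: `Ξ(L)` is a `dV`-space and `Ξ(h)` is a `dV`-map. -/
structure XiLifts : Prop where
  obj : ∀ L : KRFrm.{u}, IsDVSpace (Xi L.obj)
  map : ∀ {L M : KRFrm.{u}} (h : L ⟶ M), IsDVMap (Xi.map (KRFrm.frameHom h))

/-- The contravariant functor `Ξ`. -/
def xiFunctor (hΞ : XiLifts.{u}) : KRFrm.{u}ᵒᵖ ⥤ DVS.{u} where
  obj L := { carrier := Xi L.unop.obj, isDVSpace := hΞ.obj L.unop }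
  map h := { toFun := Xi.map (KRFrm.frameHom h.unop), isDVMap := hΞ.map h.unop }
  map_id L := by
    apply DVS.Hom.ext
    funext b
    apply Subtype.ext
    exact sSup_eq_of_forall_le_of_forall_lt_exists_gt (fun _ h => h) (fun w h => ⟨_, le_rfl, h⟩)
  map_comp {L M N} h k := by
    apply DVS.Hom.ext
    funext b
    apply Subtype.ext
    exact (gc_rightAdjoint (KRFrm.frameHom (k.unop ≫ h.unop))).u_unique
      ((gc_rightAdjoint (KRFrm.frameHom k.unop)).compose
        (gc_rightAdjoint (KRFrm.frameHom h.unop))) (fun _ => rfl)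

/-- The compact regular frame of well-rounded order-regular open sets of a `dV`-space, given that
this poset is a compact regular frame. -/
noncomputable def woroFrame (h : ∀ X : DVS.{u}, IsCompactRegularFrameOrder (WORO X))
    (X : DVS.{u}) : KRFrm.{u} :=
  ⟨@Frm.of (WORO X) (h X).frame, (h X).isCompactRegular⟩

/-- The claim that the poset of well-rounded order-regular open sets lifts to a contravariant
functor from `dV`-spaces to compact regular frames: this poset is a compact regular frame for every
`dV`-space, and inverse image under a `dV`-map restricts to a frame homomorphism. -/
structure WOROLifts : Prop where
  obj : ∀ X : DVS.{u}, IsCompactRegularFrameOrder (WORO X)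
  map : ∀ {X Y : DVS.{u}} (f : X ⟶ Y), ∃ φ : woroFrame obj Y ⟶ woroFrame obj X,
    ∀ U : WORO Y, (KRFrm.frameHom φ U : WORO X).1 = f.toFun ⁻¹' U.1

/-- The contravariant functor sending a `dV`-space to its frame of well-rounded order-regular open
sets and a `dV`-map to inverse image. -/
noncomputable def woroFunctor (hW : WOROLifts.{u}) : DVS.{u}ᵒᵖ ⥤ KRFrm.{u} where
  obj X := woroFrame hW.obj X.unop
  map f := (hW.map f.unop).choose
  map_id X := by
    apply ObjectProperty.hom_ext
    apply Frm.ext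
    intro U
    exact Subtype.ext ((hW.map (𝟙 X.unop)).choose_spec U)
  map_comp {X Y Z} f g := by
    apply ObjectProperty.hom_ext
    apply Frm.ext
    intro U
    apply Subtype.ext
    refine ((hW.map (g.unop ≫ f.unop)).choose_spec U).trans ?_
    refine Eq.trans ?_ ((hW.map g.unop).choose_spec _).symm
    exact congrArg (fun S => g.unop.toFun ⁻¹' S) ((hW.map f.unop).choose_spec U).symm

end DeVries

/-! Everything is computed in `Ξ(L)` with two families: `cobasic a`, the points `b` with `a ∨ b =
1`, and `hit a`, the points with `a ≰ b`. For compact regular `L`, the sets `cobasic a` form a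
basis, specialization is the order of `L`, `down` turns `cobasic a` into `hit a`, and `upInterior`
turns it back. Hence the order-regular open sets are exactly the `cobasic a`, all of them
well-rounded, and `L ≃o WORO (Xi L)`. The regular open ones are those with `aᶜᶜ = a`, and
`WayInside` becomes `RatherBelow`, from which the axioms of a `dV`-space follow.

Conversely, `WayInside` is a proximity on the regular open sets of a `dV`-space `X`, whose round
ideals form a compact regular frame. Sending `x` to the ideal of regular open sets whose closure
omits `x` is a homeomorphism onto `Ξ` of that frame (`toXiHomeomorph`). So `WORO X` need only be
understood for `X = Ξ(L)`.

On morphisms, the preimage of `cobasic a` under `Xi.map h` is `cobasic (h a)`. Any `dV`-map pulls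
`cobasic a` back to some `cobasic (φ a)`; `φ` preserves finite meets because `cobasic` does, and
joins because `hit` does (`exists_xiMap_eq`). Thus `Ξ` is full, faithful and essentially surjective,
and `WORO` is naturally a quasi-inverse. -/

namespace DeVries

open CategoryTheory

/-! ### The rather-below relation and compactness. -/

section RatherBelow

variable {L : Type u} [Order.Frame L]

theorem RatherBelow.le {a b : L} (h : RatherBelow a b) : a ≤ b := by
  have h' : a ⊓ (b ⊔ aᶜ) = a := by rw [h, inf_top_eq]
  rw [inf_sup_left, inf_compl_self, sup_bot_eq] at h'
  exact inf_eq_left.mp h'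

theorem ratherBelow_bot (b : L) : RatherBelow ⊥ b := by
  rw [RatherBelow, compl_bot, sup_top_eq]

theorem ratherBelow_top (a : L) : RatherBelow a ⊤ := by
  rw [RatherBelow, top_sup_eq]

theorem RatherBelow.sup {a b c : L} (ha : RatherBelow a c) (hb : RatherBelow b c) :
    RatherBelow (a ⊔ b) c := by
  rw [RatherBelow, compl_sup, sup_inf_left, ha, hb, inf_top_eq]

theorem RatherBelow.compl_compl {a b : L} (h : RatherBelow a b) : RatherBelow aᶜᶜ b := by
  rwa [RatherBelow, compl_compl_compl]

theorem ratherBelow_iff {a b : L} : RatherBelow a b ↔ ∃ c, a ⊓ c = ⊥ ∧ b ⊔ c = ⊤ := by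
  refine ⟨fun h => ⟨aᶜ, inf_compl_self a, h⟩, fun ⟨c, hac, hbc⟩ => top_le_iff.mp ?_⟩
  rw [← hbc]
  exact sup_le_sup_left (le_compl_iff_disjoint_left.mpr (disjoint_iff.mpr hac)) b

theorem le_of_sup_compl_eq_top {a b : L} (h : b ⊔ aᶜ = ⊤) : a ≤ b := RatherBelow.le h

/-- Compactness for directed joins: a finite subcover taken from the elements `s ⊔ b` is bounded by
a single one of them. With `{c | RatherBelow c a}` as the directed set, it lets `a` be shrunk inside
a cover. -/
theorem IsCompactRegular.exists_of_directed (hL : IsCompactRegular L) {S : Set L} {b : L}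
    (hne : S.Nonempty) (hd : ∀ x ∈ S, ∀ y ∈ S, ∃ z ∈ S, x ≤ z ∧ y ≤ z)
    (h : sSup S ⊔ b = ⊤) : ∃ c ∈ S, c ⊔ b = ⊤ := by
  classical
  obtain ⟨T, hT, hTtop⟩ := hL.compact ((· ⊔ b) '' S) (by
    rw [← top_le_iff, ← h]
    obtain ⟨s, hs⟩ := hne
    exact sup_le (sSup_le fun x hx => le_sup_left.trans (le_sSup (Set.mem_image_of_mem _ hx)))
      (le_sup_right.trans (le_sSup (Set.mem_image_of_mem _ hs))))
  have key : ∀ T : Finset L, (T : Set L) ⊆ (· ⊔ b) '' S →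
      ∃ c ∈ S, sSup (T : Set L) ≤ c ⊔ b := by
    intro T
    induction T using Finset.induction_on with
    | empty =>
      intro _
      obtain ⟨s, hs⟩ := hne
      exact ⟨s, hs, by simp⟩
    | insert x T _ ih =>
      intro hxT
      rw [Finset.coe_insert, Set.insert_subset_iff] at hxT
      obtain ⟨⟨s, hs, rfl⟩, hT⟩ := hxT
      obtain ⟨c, hc, hle⟩ := ih hT
      obtain ⟨z, hz, hsz, hcz⟩ := hd s hs c hc
      refine ⟨z, hz, ?_⟩
      rw [Finset.coe_insert, sSup_insert]
      exact sup_le (sup_le_sup_right hsz b) (hle.trans (sup_le_sup_right hcz b))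
  obtain ⟨c, hc, hle⟩ := key T hT
  exact ⟨c, hc, top_le_iff.mp (hTtop ▸ hle)⟩

theorem IsCompactRegular.exists_ratherBelow (hL : IsCompactRegular L) {a b : L}
    (h : a ⊔ b = ⊤) : ∃ c, RatherBelow c a ∧ c ⊔ b = ⊤ :=
  hL.exists_of_directed (S := {c | RatherBelow c a}) ⟨⊥, ratherBelow_bot a⟩
    (fun x hx y hy => ⟨x ⊔ y, RatherBelow.sup hx hy, le_sup_left, le_sup_right⟩)
    (by rwa [← hL.regular a])

theorem IsCompactRegular.exists_not_le (hL : IsCompactRegular L) {a b : L}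
    (h : ¬ a ≤ b) : ∃ c, RatherBelow c a ∧ ¬ c ≤ b := by
  by_contra! H
  exact h ((hL.regular a).le.trans (sSup_le H))

end RatherBelow

/-! ### The space of a compact regular frame. -/

section Xi

variable {L : Type u} [Order.Frame L]

/-- The elements of `Ξ(L)` whose join with `a` is the top. -/
def cobasic (a : L) : Set (Xi L) := {b | a ⊔ b.1 = ⊤}

/-- The elements of `Ξ(L)` that are not above `a`. -/
def hit (a : L) : Set (Xi L) := {b | ¬ a ≤ b.1}

theorem mem_cobasic {a : L} {b : Xi L} : b ∈ cobasic a ↔ a ⊔ b.1 = ⊤ := Iff.rfl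

theorem mem_hit {a : L} {b : Xi L} : b ∈ hit a ↔ ¬ a ≤ b.1 := Iff.rfl

theorem cobasic_mono {a a' : L} (h : a ≤ a') : cobasic a ⊆ cobasic a' :=
  fun b hb => top_le_iff.mp ((mem_cobasic.mp hb).ge.trans (sup_le_sup_right h b.1))

theorem hit_mono {a a' : L} (h : a ≤ a') : hit a ⊆ hit a' :=
  fun _ hb hle => hb (h.trans hle)

theorem cobasic_subset_hit (a : L) : cobasic a ⊆ hit a := fun b hb hle =>
  b.2 (by rwa [mem_cobasic, sup_eq_right.mpr hle] at hb)

theorem cobasic_inf (a a' : L) : cobasic (a ⊓ a') = cobasic a ∩ cobasic a' := by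
  ext b
  rw [Set.mem_inter_iff, mem_cobasic, mem_cobasic, mem_cobasic, sup_inf_right, inf_eq_top_iff]

theorem cobasic_top : cobasic (⊤ : L) = Set.univ :=
  Set.eq_univ_of_forall fun b => top_sup_eq b.1

theorem cobasic_bot : cobasic (⊥ : L) = ∅ :=
  Set.eq_empty_of_forall_notMem fun b hb => b.2 (by rwa [mem_cobasic, bot_sup_eq] at hb)

theorem hit_sSup (S : Set L) : hit (sSup S) = ⋃ a ∈ S, hit a := by
  ext b
  simp [mem_hit]

theorem hit_subset_hit {a a' : L} : hit a ⊆ hit a' ↔ a ≤ a' := by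
  refine ⟨fun h => ?_, hit_mono⟩
  by_contra hle
  have ha' : a' ≠ ⊤ := fun h => hle (h ▸ le_top)
  exact h (show (⟨a', ha'⟩ : Xi L) ∈ hit a from hle) le_rfl

theorem hit_injective : Function.Injective (hit : L → Set (Xi L)) := fun _ _ h =>
  le_antisymm (hit_subset_hit.mp h.subset) (hit_subset_hit.mp h.symm.subset)

theorem isOpen_cobasic_compl_compl (a : L) : IsOpen (cobasic aᶜᶜ) :=
  TopologicalSpace.isOpen_generateFrom_of_mem ⟨a, by
    ext b
    rw [mem_cobasic, sup_comm, Set.mem_ofPred_eq, RatherBelow]⟩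

variable (hL : IsCompactRegular L)
include hL

theorem exists_regular_cobasic {a : L} {b : Xi L} (hb : b ∈ cobasic a) :
    ∃ c : L, cᶜᶜ = c ∧ RatherBelow c a ∧ b ∈ cobasic c := by
  obtain ⟨c, hca, hcb⟩ := hL.exists_ratherBelow hb
  exact ⟨cᶜᶜ, compl_compl_compl _, hca.compl_compl, cobasic_mono le_compl_compl hcb⟩

/-- The generators of the topology are only the sets `cobasic aᶜᶜ`; regularity and compactness write
any `cobasic a` as a union of such sets. -/
theorem isOpen_cobasic (a : L) : IsOpen (cobasic a) := by
  rw [isOpen_iff_forall_mem_open]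
  intro b hb
  obtain ⟨c, hc, hca, hcb⟩ := exists_regular_cobasic hL hb
  exact ⟨cobasic c, cobasic_mono hca.le, hc ▸ isOpen_cobasic_compl_compl c, hcb⟩

theorem isTopologicalBasis_cobasic :
    TopologicalSpace.IsTopologicalBasis (Set.range (cobasic : L → Set (Xi L))) where
  exists_subset_inter := by
    rintro _ ⟨a, rfl⟩ _ ⟨a', rfl⟩ b hb
    exact ⟨cobasic (a ⊓ a'), ⟨_, rfl⟩, by rwa [cobasic_inf], by rw [cobasic_inf]⟩
  sUnion_eq := Set.eq_univ_of_univ_subset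
    (Set.subset_sUnion_of_mem ⟨⊤, cobasic_top⟩)
  eq_generateFrom := by
    apply le_antisymm
    · apply le_generateFrom
      rintro _ ⟨a, rfl⟩
      exact isOpen_cobasic hL a
    · apply le_generateFrom
      rintro _ ⟨a, rfl⟩
      refine TopologicalSpace.isOpen_generateFrom_of_mem ⟨aᶜᶜ, ?_⟩
      ext b
      rw [mem_cobasic, sup_comm, Set.mem_ofPred_eq, RatherBelow]

theorem specLE_iff {b b' : Xi L} : SpecLE b b' ↔ b.1 ≤ b'.1 := by
  constructor
  · intro h
    rw [hL.regular b.1]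
    refine sSup_le fun c hc => ?_
    have : b' ∈ cobasic cᶜ := h _ (isOpen_cobasic hL _) (by rw [mem_cobasic, sup_comm]; exact hc)
    rw [mem_cobasic, sup_comm] at this
    exact le_of_sup_compl_eq_top this
  · intro h U hU hb
    obtain ⟨_, ⟨a, rfl⟩, hba, haU⟩ :=
      (isTopologicalBasis_cobasic hL).exists_subset_of_mem_open hb hU
    exact haU (top_le_iff.mp ((mem_cobasic.mp hba).ge.trans (sup_le_sup_left h a)))

theorem down_cobasic (a : L) : down (cobasic a) = hit a := by
  ext b
  constructor
  · rintro ⟨b', hb', hle⟩ hab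
    exact cobasic_subset_hit a hb' (hab.trans ((specLE_iff hL).mp hle))
  · intro hab
    obtain ⟨c, hca, hcb⟩ := hL.exists_not_le hab
    -- `b ∨ ¬c` is proper because `c ≰ b`, and joins with `a` to the top because `c ≺ a`.
    refine ⟨⟨b.1 ⊔ cᶜ, fun h => hcb (le_of_sup_compl_eq_top h)⟩, ?_,
      (specLE_iff hL).mpr le_sup_left⟩
    change a ⊔ (b.1 ⊔ cᶜ) = ⊤
    rw [sup_left_comm, show a ⊔ cᶜ = ⊤ from hca, sup_top_eq]

/-- The witness is the join of all `c` whose `cobasic c` occurs in a decomposition of `U` into basic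
sets. Basic sets are disjoint exactly when their indices are, so `cobasic aᶜ` is the largest basic
set missing `U`. -/
theorem exists_down_eq_hit {U : Set (Xi L)} (hU : IsOpen U) :
    ∃ a, down U = hit a ∧ perp U = cobasic aᶜ := by
  obtain ⟨S, hS, rfl⟩ := (isTopologicalBasis_cobasic hL).open_eq_sUnion hU
  refine ⟨sSup {a | cobasic a ∈ S}, ?_, ?_⟩
  · rw [hit_sSup]
    ext b
    simp only [Set.mem_iUnion, Set.mem_ofPred_eq, exists_prop, ← down_cobasic hL]
    constructor
    · rintro ⟨b', ⟨s, hs, hb'⟩, hle⟩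
      obtain ⟨a, rfl⟩ := hS hs
      exact ⟨a, hs, b', hb', hle⟩
    · rintro ⟨a, ha, b', hb', hle⟩
      exact ⟨b', ⟨_, ha, hb'⟩, hle⟩
  · ext b
    rw [perp, Set.mem_compl_iff, (isTopologicalBasis_cobasic hL).mem_closure_iff]
    have disj : ∀ a c : L, cobasic a ∩ cobasic c = ∅ ↔ a ⊓ c = ⊥ := by
      intro a c
      rw [← cobasic_inf]
      refine ⟨fun h => ?_, fun h => h ▸ cobasic_bot⟩
      refine hit_injective ?_
      rw [← down_cobasic hL, ← down_cobasic hL, h, cobasic_bot]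
    constructor
    · intro h
      push Not at h
      obtain ⟨_, ⟨c, rfl⟩, hbc, hc⟩ := h
      refine cobasic_mono ?_ hbc
      rw [le_compl_iff_disjoint_right, disjoint_sSup_iff]
      intro a ha
      rw [disjoint_iff, ← disj, ← Set.subset_empty_iff, ← hc]
      exact Set.inter_subset_inter_right _ (Set.subset_sUnion_of_mem ha)
    · intro hb h
      obtain ⟨b', hb', s, hs, hb's⟩ := h _ ⟨_, rfl⟩ hb
      obtain ⟨a, rfl⟩ := hS hs
      have : b' ∈ cobasic (sSup {a | cobasic a ∈ S})ᶜ ∩ cobasic a := ⟨hb', hb's⟩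
      rw [(disj _ _).mpr] at this
      · exact this
      · rw [← disjoint_iff]
        exact disjoint_compl_left.mono_right (le_sSup (show a ∈ {a | cobasic a ∈ S} from hs))

theorem perp_cobasic (a : L) : perp (cobasic a) = cobasic aᶜ := by
  obtain ⟨a', hd, hp⟩ := exists_down_eq_hit hL (isOpen_cobasic hL a)
  rw [down_cobasic hL] at hd
  rw [hp, hit_injective hd]

theorem upInterior_hit (a : L) : upInterior (hit a) = cobasic a := by
  ext b
  constructor
  · intro h
    by_contra hb
    -- If `a ∨ b` is not the top, it is itself a point above `b` outside `hit a`.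
    exact h ⟨a ⊔ b.1, hb⟩ ((specLE_iff hL).mpr le_sup_right) le_sup_left
  · intro h b' hb'
    exact cobasic_subset_hit a (hb' _ (isOpen_cobasic hL a) h)

theorem isOrderRegularOpen_cobasic (a : L) : IsOrderRegularOpen (cobasic a) := by
  rw [IsOrderRegularOpen, down_cobasic hL, upInterior_hit hL]

theorem exists_eq_cobasic {U : Set (Xi L)} (hU : IsOpen U) (hU' : IsOrderRegularOpen U) :
    ∃ a, U = cobasic a := by
  obtain ⟨a, hd, -⟩ := exists_down_eq_hit hL hU
  exact ⟨a, by rw [← hU', hd, upInterior_hit hL]⟩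

theorem cobasic_subset_cobasic {a a' : L} : cobasic a ⊆ cobasic a' ↔ a ≤ a' := by
  refine ⟨fun h => hit_subset_hit.mp ?_, cobasic_mono⟩
  rw [← down_cobasic hL, ← down_cobasic hL]
  exact fun b ⟨b', hb', hle⟩ => ⟨b', h hb', hle⟩

theorem cobasic_injective : Function.Injective (cobasic : L → Set (Xi L)) := fun _ _ h =>
  le_antisymm ((cobasic_subset_cobasic hL).mp h.subset)
    ((cobasic_subset_cobasic hL).mp h.symm.subset)

theorem isRegularOpen_cobasic {a : L} : IsRegularOpen (cobasic a) ↔ aᶜᶜ = a := by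
  rw [IsRegularOpen, perp_cobasic hL, perp_cobasic hL]
  exact (cobasic_injective hL).eq_iff

theorem isRegularOpen_iff {U : Set (Xi L)} :
    IsRegularOpen U ↔ ∃ a : L, aᶜᶜ = a ∧ U = cobasic a := by
  constructor
  · intro h
    obtain ⟨a, -, hp⟩ := exists_down_eq_hit hL (U := perp U) isClosed_closure.isOpen_compl
    have hU : U = cobasic aᶜ := by rw [← hp]; exact h.symm
    exact ⟨aᶜ, compl_compl_compl a, hU⟩
  · rintro ⟨a, ha, rfl⟩
    exact (isRegularOpen_cobasic hL).mpr ha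

theorem closure_cobasic (a : L) : closure (cobasic a) = (cobasic aᶜ)ᶜ := by
  rw [← perp_cobasic hL, perp, compl_compl]

theorem wayInside_cobasic {a a' : L} :
    WayInside (cobasic a) (cobasic a') ↔ RatherBelow a a' := by
  rw [WayInside, closure_cobasic hL, down_cobasic hL]
  constructor
  · intro h
    by_contra hn
    -- Were `a' ∨ ¬a` proper, it would be a point in the closure of `cobasic a` but not in `hit a'`.
    exact h (a := ⟨a' ⊔ aᶜ, hn⟩)
      (fun h' => hn (by
        change aᶜ ⊔ (a' ⊔ aᶜ) = ⊤ at h'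
        rwa [sup_left_comm, sup_idem] at h')) le_sup_left
  · intro h b hb hle
    refine hb (top_le_iff.mp ?_)
    rw [sup_comm]
    exact h.ge.trans (sup_le_sup_right hle _)

/-- Closed subsets of `hit a` are already contained in `hit c` for some `c` rather below `a`. -/
theorem exists_subset_hit {a : L} {A : Set (Xi L)} (hA : IsClosed A) (h : A ⊆ hit a) :
    ∃ c, RatherBelow c a ∧ A ⊆ hit c := by
  by_cases ha : a = ⊤
  · exact ⟨a, ha ▸ ratherBelow_top _, h⟩
  -- The element `a` is itself a point outside `hit a`, hence outside `A`; a basic neighbourhood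
  -- `cobasic d` of it misses `A`, and `a` is then shrunk to `c` with `c ∨ d = 1`.
  · have haA : (⟨a, ha⟩ : Xi L) ∈ Aᶜ := fun h' => h h' le_rfl
    obtain ⟨_, ⟨d, rfl⟩, had, hd⟩ :=
      (isTopologicalBasis_cobasic hL).exists_subset_of_mem_open haA hA.isOpen_compl
    obtain ⟨c, hca, hcd⟩ := hL.exists_ratherBelow ((sup_comm a d).trans had)
    refine ⟨c, hca, fun b hb hcb => hd ?_ hb⟩
    exact top_le_iff.mp ((sup_comm d c).trans hcd |>.ge.trans (sup_le_sup_left hcb d))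

theorem isWellRounded_cobasic (a : L) : IsWellRounded (cobasic a) := by
  refine ⟨isOpen_cobasic hL a, fun B hB hBa => ?_⟩
  rw [down_cobasic hL] at hBa ⊢
  obtain ⟨c, hca, hBc⟩ := exists_subset_hit hL hB hBa
  refine ⟨cobasic c, cobasic cᶜ, isOpen_cobasic hL _, isOpen_cobasic hL _, ?_,
    (down_cobasic hL c).symm ▸ hBc, fun b hb hab => hb ?_⟩
  · rw [Set.disjoint_iff_inter_eq_empty, ← cobasic_inf, inf_compl_self, cobasic_bot]
  · rw [mem_cobasic, sup_comm]
    exact top_le_iff.mp (hca.ge.trans (sup_le_sup_right hab _))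

theorem isOrderNormal_xi : IsOrderNormal (Xi L) := by
  intro A B hA hB hAB
  obtain ⟨a, hd, hp⟩ := exists_down_eq_hit hL (isOpen_interior (s := B))
  -- The complement of `B` is `cobasic aᶜ`, so that of `upInterior B` is `hit aᶜ`; normality thus
  -- reduces to `exists_subset_hit`.
  have hBa : upInterior B = {b : Xi L | aᶜ ≤ b.1} := by
    have hB' : Bᶜ = cobasic aᶜ := by rw [← hp, perp, hB]
    have hd' : (upInterior B)ᶜ = hit aᶜ := by
      rw [← down_cobasic hL, ← hB']
      ext b
      simp only [upInterior, down, Set.mem_compl_iff, Set.mem_ofPred_eq]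
      push Not
      exact exists_congr fun _ => and_comm
    rw [← compl_compl (upInterior B), hd']
    ext b
    simp [mem_hit]
  have hA' : A ⊆ hit aᶜ := fun b hb hab =>
    Set.disjoint_left.mp hAB hb (by rw [hBa]; exact hab)
  obtain ⟨c, hca, hAc⟩ := exists_subset_hit hL hA hA'
  refine ⟨cobasic c, cobasic cᶜ, isOpen_cobasic hL _, isOpen_cobasic hL _, ?_,
    (down_cobasic hL c).symm ▸ hAc, ?_⟩
  · rw [Set.disjoint_iff_inter_eq_empty, ← cobasic_inf, inf_compl_self, cobasic_bot]
  · rw [hBa]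
    intro b hb
    rw [mem_cobasic, sup_comm]
    exact top_le_iff.mp (hca.ge.trans (sup_le_sup_right hb _))

theorem compactSpace_xi : CompactSpace (Xi L) := by
  refine ⟨isCompact_of_finite_subcover fun {ι} U hU hcov => ?_⟩
  rcases isEmpty_or_nonempty (Xi L) with hE | ⟨⟨b⟩⟩
  · exact ⟨∅, fun x => (hE.false x).elim⟩
  · have hbot : (⊥ : L) ≠ ⊤ := fun h => b.2 (top_le_iff.mp (h.ge.trans bot_le))
    -- `⊥` is the least point, so an open set containing it is the whole space.
    obtain ⟨i, hi⟩ := Set.mem_iUnion.mp (hcov (Set.mem_univ (⟨⊥, hbot⟩ : Xi L)))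
    exact ⟨{i}, fun x _ => Set.mem_iUnion₂.mpr ⟨i, Finset.mem_singleton_self i,
      (specLE_iff hL).mpr bot_le _ (hU i) hi⟩⟩

theorem t0Space_xi : T0Space (Xi L) := by
  refine ⟨fun b b' h => ?_⟩
  have key : ∀ b b' : Xi L, Inseparable b b' → b.1 ≤ b'.1 := fun b b' h =>
    (specLE_iff hL).mp fun U hU hb => (h.mem_open_iff hU).mp hb
  exact Subtype.ext (le_antisymm (key b b' h) (key b' b h.symm))

theorem isConcordant_regularNhds_xi (b : Xi L) : IsConcordant (regularNhds b) where
  isROFilter :=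
    { regular := fun U hU => hU.1
      univ_mem := ⟨(isRegularOpen_iff hL).mpr
        ⟨⊤, by rw [compl_top, compl_bot], cobasic_top.symm⟩, trivial⟩
      inter_mem := by
        rintro U ⟨hU, hbU⟩ V ⟨hV, hbV⟩
        obtain ⟨a, ha, rfl⟩ := (isRegularOpen_iff hL).mp hU
        obtain ⟨c, hc, rfl⟩ := (isRegularOpen_iff hL).mp hV
        refine ⟨?_, hbU, hbV⟩
        rw [← cobasic_inf, isRegularOpen_cobasic hL]
        exact Heyting.IsRegular.inf ha hc
      mem_of_subset := fun U hU V hV hUV => ⟨hV, hUV hU.2⟩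
      empty_notMem := fun h => h.2 }
  roundPart_eq := by
    refine Set.Subset.antisymm (fun U hU => hU.1) ?_
    rintro U ⟨hU, hbU⟩
    refine ⟨⟨hU, hbU⟩, ?_⟩
    obtain ⟨a, ha, rfl⟩ := (isRegularOpen_iff hL).mp hU
    obtain ⟨c, hc, hca, hbc⟩ := exists_regular_cobasic hL hbU
    exact ⟨cobasic c, ⟨(isRegularOpen_cobasic hL).mpr hc, hbc⟩, (wayInside_cobasic hL).mpr hca⟩

theorem exists_roundPart_eq_regularNhds_xi {F : Set (Set (Xi L))} (hF : IsROFilter F) :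
    ∃ b : Xi L, roundPart F = regularNhds b := by
  -- The required point is the join of these pseudo-complements. They are directed since `F` is
  -- closed under intersection, so compactness and properness of `F` keep the join below the top.
  let S : Set L := {d | ∃ c, cobasic c ∈ F ∧ d = cᶜ}
  have hne : S.Nonempty := ⟨_, ⊤, by rw [cobasic_top]; exact hF.univ_mem, rfl⟩
  have hd : ∀ x ∈ S, ∀ y ∈ S, ∃ z ∈ S, x ≤ z ∧ y ≤ z := by
    rintro _ ⟨c, hc, rfl⟩ _ ⟨c', hc', rfl⟩
    exact ⟨_, ⟨c ⊓ c', by rw [cobasic_inf]; exact hF.inter_mem _ hc _ hc', rfl⟩,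
      compl_le_compl inf_le_left, compl_le_compl inf_le_right⟩
  have hS : sSup S ≠ ⊤ := by
    intro h
    obtain ⟨_, ⟨c, hc, rfl⟩, hctop⟩ := hL.exists_of_directed (b := ⊥) hne hd (by rw [h, sup_bot_eq])
    have hc0 : c = ⊥ :=
      le_bot_iff.mp (le_of_sup_compl_eq_top ((sup_comm _ _).trans hctop))
    rw [hc0, cobasic_bot] at hc
    exact hF.empty_notMem hc
  refine ⟨⟨sSup S, hS⟩, Set.Subset.antisymm ?_ ?_⟩
  · rintro V ⟨hV, U, hU, hUV⟩
    refine ⟨hF.regular V hV, ?_⟩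
    obtain ⟨a, ha, rfl⟩ := (isRegularOpen_iff hL).mp (hF.regular V hV)
    obtain ⟨c, hc, rfl⟩ := (isRegularOpen_iff hL).mp (hF.regular U hU)
    exact top_le_iff.mp (((wayInside_cobasic hL).mp hUV).ge.trans
      (sup_le_sup_left (le_sSup (show cᶜ ∈ S from ⟨c, hU, rfl⟩)) a))
  · rintro V ⟨hV, hbV⟩
    obtain ⟨a, ha, rfl⟩ := (isRegularOpen_iff hL).mp hV
    obtain ⟨_, ⟨c, hc, rfl⟩, hca⟩ :=
      hL.exists_of_directed hne hd ((sup_comm _ _).trans (mem_cobasic.mp hbV))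
    have hca' : RatherBelow c a := (sup_comm _ _).trans hca
    exact ⟨hF.mem_of_subset _ hc _ hV (cobasic_mono hca'.le), _, hc, (wayInside_cobasic hL).mpr hca'⟩

theorem isDVSpace_xi : IsDVSpace (Xi L) where
  t0 := t0Space_xi hL
  compact := compactSpace_xi hL
  orderNormal := isOrderNormal_xi hL
  basis := by
    refine TopologicalSpace.isTopologicalBasis_of_isOpen_of_nhds ?_ ?_
    · intro U hU
      obtain ⟨a, -, rfl⟩ := (isRegularOpen_iff hL).mp hU
      exact isOpen_cobasic hL a
    · intro b U hb hU
      obtain ⟨_, ⟨a, rfl⟩, hba, ha⟩ :=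
        (isTopologicalBasis_cobasic hL).exists_subset_of_mem_open hb hU
      obtain ⟨c, hc, hca, hbc⟩ := exists_regular_cobasic hL hba
      exact ⟨cobasic c, (isRegularOpen_cobasic hL).mpr hc, hbc, (cobasic_mono hca.le).trans ha⟩
  orderRegular := by
    intro U hU
    obtain ⟨a, -, rfl⟩ := (isRegularOpen_iff hL).mp hU
    exact isOrderRegularOpen_cobasic hL a
  concordant := isConcordant_regularNhds_xi hL
  exists_point _ hF := exists_roundPart_eq_regularNhds_xi hL hF

/-- A compact regular frame is isomorphic to the poset of well-rounded order-regular open subsets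
of its space `Ξ(L)`. -/
noncomputable def cobasicIso : L ≃o WORO (Xi L) where
  toEquiv := Equiv.ofBijective
    (fun a => ⟨cobasic a, isWellRounded_cobasic hL a, isOrderRegularOpen_cobasic hL a⟩)
    ⟨fun _ _ h => cobasic_injective hL (congrArg Subtype.val h), fun U => by
      obtain ⟨a, ha⟩ := exists_eq_cobasic hL U.2.1.isOpen U.2.2
      exact ⟨a, Subtype.ext ha.symm⟩⟩
  map_rel_iff' := cobasic_subset_cobasic hL

end Xi

/-! ### Frame homomorphisms versus `dV`-maps. -/

section XiMap

variable {L M : Type u} [Order.Frame L] [Order.Frame M]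
  (hL : IsCompactRegular L) (hM : IsCompactRegular M)
include hL hM

/-- From right to left, choose `c ≺ a` with `h c ∨ b = 1`. Then `h (¬c) ≤ b`, so `¬c` lies below the
adjoint of `b`, and `a ∨ ¬c = 1`. -/
theorem sup_rightAdjoint_eq_top_iff (h : FrameHom L M) (a : L) (b : M) :
    a ⊔ rightAdjoint h b = ⊤ ↔ h a ⊔ b = ⊤ := by
  constructor
  · intro H
    rw [← top_le_iff, ← map_top h, ← H, map_sup]
    exact sup_le_sup_left ((gc_rightAdjoint h).l_u_le _) _
  · intro H
    rw [hL.regular a, map_sSup] at H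
    obtain ⟨_, ⟨c, hc, rfl⟩, hcb⟩ := hM.exists_of_directed
      (S := h '' {c | RatherBelow c a}) ⟨_, ⊥, ratherBelow_bot a, rfl⟩ (by
        rintro _ ⟨c, hc, rfl⟩ _ ⟨c', hc', rfl⟩
        exact ⟨_, ⟨c ⊔ c', RatherBelow.sup hc hc', rfl⟩, OrderHomClass.mono h le_sup_left,
          OrderHomClass.mono h le_sup_right⟩) H
    have hle : h cᶜ ≤ b := by
      rw [← inf_top_eq (h cᶜ), ← hcb, inf_sup_left, ← map_inf, compl_inf_self, map_bot,
        bot_sup_eq]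
      exact inf_le_right
    have hc' : RatherBelow c a := hc
    exact top_le_iff.mp (hc'.ge.trans (sup_le_sup_left ((gc_rightAdjoint h).le_u hle) a))

theorem preimage_xiMap_cobasic (h : FrameHom L M) (a : L) :
    Xi.map h ⁻¹' cobasic a = cobasic (h a) :=
  Set.ext fun b => sup_rightAdjoint_eq_top_iff hL hM h a b.1

theorem isDVMap_xiMap (h : FrameHom L M) : IsDVMap (Xi.map h) where
  continuous := by
    refine (isTopologicalBasis_cobasic hL).continuous_iff.mpr ?_
    rintro _ ⟨a, rfl⟩
    rw [preimage_xiMap_cobasic hL hM]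
    exact isOpen_cobasic hM _
  weaklyDense b y hy := by
    have hle : rightAdjoint h b.1 ≤ y.1 := (specLE_iff hL).mp hy
    refine ⟨⟨h y.1 ⊔ b.1, fun H => y.2 ?_⟩, (specLE_iff hM).mpr le_sup_right,
      (specLE_iff hL).mpr ((gc_rightAdjoint h).le_u le_sup_left)⟩
    rwa [← sup_rightAdjoint_eq_top_iff hL hM, sup_eq_left.mpr hle] at H

omit hL hM in
theorem xiMap_injective : Function.Injective (Xi.map : FrameHom L M → Xi M → Xi L) := by
  intro h k H
  have hr : ∀ b : M, rightAdjoint h b = rightAdjoint k b := by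
    intro b
    by_cases hb : b = ⊤
    · rw [hb, (gc_rightAdjoint h).u_top, (gc_rightAdjoint k).u_top]
    · exact congrArg Subtype.val (congrFun H ⟨b, hb⟩)
  exact DFunLike.ext _ _ fun a =>
    (gc_rightAdjoint h).l_unique (gc_rightAdjoint k) (fun b => hr b)

/-- Every `dV`-map `Ξ(M) → Ξ(L)` is induced by a frame homomorphism `L → M`. -/
theorem exists_xiMap_eq {g : Xi M → Xi L} (hg : IsDVMap g) :
    ∃ h : FrameHom L M, Xi.map h = g := by
  -- Weak density is what makes `down` commute with taking preimages of these open sets.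
  have hdown : ∀ a : L, down (g ⁻¹' cobasic a) = g ⁻¹' hit a := by
    intro a
    rw [← down_cobasic hL]
    ext b
    constructor
    · rintro ⟨b', hb', hle⟩
      exact ⟨g b', hb', hle.map hg.continuous⟩
    · rintro ⟨y, hy, hle⟩
      obtain ⟨b', hbb', hyb'⟩ := hg.weaklyDense b y hle
      exact ⟨b', hyb' _ (isOpen_cobasic hL a) hy, hbb'⟩
  have hex : ∀ a : L, ∃ c : M, g ⁻¹' cobasic a = cobasic c := by
    intro a
    refine exists_eq_cobasic hM ((isOpen_cobasic hL a).preimage hg.continuous) ?_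
    rw [IsOrderRegularOpen, hdown]
    ext b
    constructor
    · intro H
      by_contra hb
      -- A proper `a ∨ g b` is a point above `g b`; weak density finds `b'` above `b` with `a ≤ g
      -- b'`.
      obtain ⟨b', hbb', hyb'⟩ := hg.weaklyDense b ⟨a ⊔ (g b).1, hb⟩
        ((specLE_iff hL).mpr le_sup_right)
      exact H b' hbb' (le_sup_left.trans ((specLE_iff hL).mp hyb'))
    · intro hb b' hbb'
      exact cobasic_subset_hit a (hbb'.map hg.continuous _ (isOpen_cobasic hL a) hb)
  choose φ hφ using hex
  have hφ' : ∀ a, hit (φ a) = g ⁻¹' hit a := fun a => by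
    rw [← hdown, hφ, down_cobasic hM]
  let h : FrameHom L M :=
    { toFun := φ
      map_inf' := fun a a' => cobasic_injective hM (by
        rw [cobasic_inf, ← hφ, ← hφ, ← hφ, cobasic_inf, Set.preimage_inter])
      map_top' := cobasic_injective hM (by rw [← hφ, cobasic_top, cobasic_top, Set.preimage_univ])
      map_sSup' := fun S => hit_injective (by
        rw [hφ', hit_sSup, hit_sSup, Set.biUnion_image, Set.preimage_iUnion₂]
        simp only [hφ']) }
  refine ⟨h, funext fun b => ?_⟩
  have := t0Space_xi hL
  refine Inseparable.eq ?_
  refine (isTopologicalBasis_cobasic hL).inseparable_iff.mpr ?_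
  rintro _ ⟨a, rfl⟩
  exact Set.ext_iff.mp ((preimage_xiMap_cobasic hL hM h a).trans (hφ a).symm) b

end XiMap

/-! ### The compact regular frame of round ideals of a proximity. -/

section RoundIdeals

/-- De Vries proximities on a Boolean algebra, without the axiom on joins of ideals. -/
structure IsProximity {B : Type u} [BooleanAlgebra B] (r : B → B → Prop) : Prop where
  bot : r ⊥ ⊥
  le : ∀ {a b}, r a b → a ≤ b
  mono : ∀ {a a' b b'}, a' ≤ a → r a b → b ≤ b' → r a' b'
  inf : ∀ {a b c}, r a b → r a c → r a (b ⊓ c)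
  compl : ∀ {a b}, r a b → r bᶜ aᶜ
  interpolate : ∀ {a b}, r a b → ∃ c, r a c ∧ r c b

namespace IsProximity

variable {B : Type u} [BooleanAlgebra B] {r : B → B → Prop}

theorem sup (hr : IsProximity r) {a b c : B} (ha : r a c) (hb : r b c) : r (a ⊔ b) c := by
  have h := hr.compl (hr.inf (hr.compl ha) (hr.compl hb))
  rwa [compl_compl, compl_inf, compl_compl, compl_compl] at h

theorem sup_sup (hr : IsProximity r) {a a' b b' : B} (ha : r a a') (hb : r b b') :
    r (a ⊔ b) (a' ⊔ b') :=
  hr.sup (hr.mono le_rfl ha le_sup_left) (hr.mono le_rfl hb le_sup_right)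

end IsProximity

/-- Round ideals of a Boolean algebra with a proximity. -/
@[ext]
structure RoundIdeal {B : Type u} [BooleanAlgebra B] {r : B → B → Prop}
    (hr : IsProximity r) : Type u where
  carrier : Set B
  bot_mem : ⊥ ∈ carrier
  sup_mem : ∀ {a b}, a ∈ carrier → b ∈ carrier → a ⊔ b ∈ carrier
  lower : ∀ {a b}, a ≤ b → b ∈ carrier → a ∈ carrier
  round : ∀ {a}, a ∈ carrier → ∃ b ∈ carrier, r a b

namespace RoundIdeal

variable {B : Type u} [BooleanAlgebra B] {r : B → B → Prop} {hr : IsProximity r}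

instance : PartialOrder (RoundIdeal hr) :=
  PartialOrder.lift carrier fun _ _ h => RoundIdeal.ext h

theorem le_def {I J : RoundIdeal hr} : I ≤ J ↔ I.carrier ⊆ J.carrier := Iff.rfl

/-- The ideal generated by a set of round ideals. -/
inductive Generated (S : Set (RoundIdeal hr)) : B → Prop
  | bot : Generated S ⊥
  | of_mem {I : RoundIdeal hr} {a : B} : I ∈ S → a ∈ I.carrier → Generated S a
  | sup {a b : B} : Generated S a → Generated S b → Generated S (a ⊔ b)
  | lower {a b : B} : a ≤ b → Generated S b → Generated S a

theorem Generated.mono {S T : Set (RoundIdeal hr)} (h : S ⊆ T) {a : B} (ha : Generated S a) :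
    Generated T a := by
  induction ha with
  | bot => exact .bot
  | of_mem hI ha => exact .of_mem (h hI) ha
  | sup _ _ ha hb => exact .sup ha hb
  | lower hab _ hb => exact .lower hab hb

theorem Generated.exists_finset {S : Set (RoundIdeal hr)} {a : B} (ha : Generated S a) :
    ∃ T : Finset (RoundIdeal hr), (T : Set (RoundIdeal hr)) ⊆ S ∧
      Generated (T : Set (RoundIdeal hr)) a := by
  classical
  induction ha with
  | bot => exact ⟨∅, by simp, .bot⟩
  | @of_mem I a hI ha => exact ⟨{I}, by simpa using hI, .of_mem (by simp) ha⟩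
  | sup _ _ ha hb =>
    obtain ⟨T, hT, ha⟩ := ha
    obtain ⟨T', hT', hb⟩ := hb
    exact ⟨T ∪ T', by simp [hT, hT'], .sup (ha.mono (by simp)) (hb.mono (by simp))⟩
  | lower hab _ hb =>
    obtain ⟨T, hT, hb⟩ := hb
    exact ⟨T, hT, .lower hab hb⟩

instance : SupSet (RoundIdeal hr) where
  sSup S :=
    { carrier := {a | Generated S a}
      bot_mem := .bot
      sup_mem := .sup
      lower := fun h hb => Generated.lower h hb
      round := by
        intro a ha
        induction ha with
        | bot => exact ⟨⊥, .bot, hr.bot⟩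
        | @of_mem I a hI ha =>
          obtain ⟨b, hb, hab⟩ := I.round ha
          exact ⟨b, .of_mem hI hb, hab⟩
        | sup _ _ ha hb =>
          obtain ⟨c, hc, hac⟩ := ha
          obtain ⟨d, hd, hbd⟩ := hb
          exact ⟨c ⊔ d, .sup hc hd, hr.sup_sup hac hbd⟩
        | lower hab _ hb =>
          obtain ⟨c, hc, hbc⟩ := hb
          exact ⟨c, hc, hr.mono hab hbc le_rfl⟩ }

theorem mem_sSup {S : Set (RoundIdeal hr)} {a : B} : a ∈ (sSup S).carrier ↔ Generated S a :=
  Iff.rfl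

/-- The intersection of two round ideals. -/
def inter (I J : RoundIdeal hr) : RoundIdeal hr where
  carrier := I.carrier ∩ J.carrier
  bot_mem := ⟨I.bot_mem, J.bot_mem⟩
  sup_mem ha hb := ⟨I.sup_mem ha.1 hb.1, J.sup_mem ha.2 hb.2⟩
  lower h hb := ⟨I.lower h hb.1, J.lower h hb.2⟩
  round ha := by
    obtain ⟨b, hb, hab⟩ := I.round ha.1
    obtain ⟨c, hc, hac⟩ := J.round ha.2
    exact ⟨b ⊓ c, ⟨I.lower inf_le_left hb, J.lower inf_le_right hc⟩, hr.inf hab hac⟩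

instance : CompleteLattice (RoundIdeal hr) where
  inf := inter
  inf_le_left _ _ _ ha := ha.1
  inf_le_right _ _ _ ha := ha.2
  le_inf _ _ _ h h' _ ha := ⟨h ha, h' ha⟩
  __ := completeLatticeOfSup (RoundIdeal hr) fun S => by
    refine ⟨fun I hI a ha => Generated.of_mem hI ha, fun J hJ a ha => ?_⟩
    rw [mem_sSup] at ha
    induction ha with
    | bot => exact J.bot_mem
    | of_mem hI ha => exact hJ hI ha
    | sup _ _ ha hb => exact J.sup_mem ha hb
    | lower hab _ hb => exact J.lower hab hb

theorem mem_inf {I J : RoundIdeal hr} {a : B} :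
    a ∈ (I ⊓ J).carrier ↔ a ∈ I.carrier ∧ a ∈ J.carrier := Iff.rfl

instance : Order.Frame (RoundIdeal hr) :=
  Order.Frame.ofMinimalAxioms
    { inf_sSup_le_iSup_inf := by
        rintro I S a ⟨haI, ha⟩
        rw [mem_sSup] at ha
        -- The elements met in the induction need not lie in `I`, so they are cut down by a fixed `x
        -- ∈ I`; finally `x = a`.
        have key : ∀ x ∈ I.carrier, x ⊓ a ∈ (⨆ J ∈ S, I ⊓ J).carrier := by
          intro x hx
          clear haI
          induction ha with
          | bot => rw [inf_bot_eq]; exact bot_mem _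
          | @of_mem J a hJ ha =>
            exact le_def.mp (le_iSup₂ (f := fun J (_ : J ∈ S) => I ⊓ J) J hJ)
              (mem_inf.mpr ⟨I.lower inf_le_left hx, J.lower inf_le_right ha⟩)
          | sup _ _ ha hb =>
            rw [inf_sup_left]
            exact sup_mem _ ha hb
          | lower hab _ hb => exact lower _ (inf_le_inf_left x hab) hb
        simpa using key a haI }

theorem mem_sup {I J : RoundIdeal hr} {a : B} :
    a ∈ (I ⊔ J).carrier ↔ ∃ b ∈ I.carrier, ∃ c ∈ J.carrier, a ≤ b ⊔ c := by
  constructor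
  · intro ha
    rw [← sSup_pair, mem_sSup] at ha
    induction ha with
    | bot => exact ⟨⊥, I.bot_mem, ⊥, J.bot_mem, bot_le⟩
    | @of_mem K a hK ha =>
      rcases hK with rfl | rfl
      · exact ⟨a, ha, ⊥, J.bot_mem, le_sup_left⟩
      · exact ⟨⊥, I.bot_mem, a, ha, le_sup_right⟩
    | sup _ _ iha ihb =>
      obtain ⟨b, hb, c, hc, h⟩ := iha
      obtain ⟨b', hb', c', hc', h'⟩ := ihb
      exact ⟨b ⊔ b', I.sup_mem hb hb', c ⊔ c', J.sup_mem hc hc',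
        (sup_le_sup h h').trans (sup_sup_sup_comm _ _ _ _).le⟩
    | lower hab _ hb =>
      obtain ⟨b, hb, c, hc, h⟩ := hb
      exact ⟨b, hb, c, hc, hab.trans h⟩
  · rintro ⟨b, hb, c, hc, h⟩
    exact lower _ h (sup_mem _ (le_def.mp le_sup_left hb) (le_def.mp le_sup_right hc))

/-- The principal round ideal of the elements in proximity to `b`. -/
def principal (hr : IsProximity r) (b : B) : RoundIdeal hr where
  carrier := {a | r a b}
  bot_mem := hr.mono le_rfl hr.bot bot_le
  sup_mem := hr.sup
  lower h hb := hr.mono h hb le_rfl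
  round ha := by
    obtain ⟨c, hac, hcb⟩ := hr.interpolate ha
    exact ⟨c, hcb, hac⟩

theorem mem_principal {a b : B} : a ∈ (principal hr b).carrier ↔ r a b := Iff.rfl

theorem eq_top_iff_mem (htop : r ⊤ ⊤) {I : RoundIdeal hr} : I = ⊤ ↔ ⊤ ∈ I.carrier := by
  constructor
  · rintro rfl
    exact le_def.mp (le_top (a := principal hr ⊤)) htop
  · exact fun h => top_le_iff.mp (le_def.mpr fun a _ => I.lower le_top h)

theorem principal_ratherBelow (htop : r ⊤ ⊤) {I : RoundIdeal hr} {b : B} (hb : b ∈ I.carrier) :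
    RatherBelow (principal hr b) I := by
  refine ratherBelow_iff.mpr ⟨principal hr bᶜ, ?_, ?_⟩
  · refine le_bot_iff.mp (le_def.mpr fun a ha => ?_)
    obtain ⟨h, h'⟩ := mem_inf.mp ha
    have ha0 : a = ⊥ := le_bot_iff.mp ((le_inf (hr.le h) (hr.le h')).trans (inf_compl_self b).le)
    exact ha0 ▸ bot_mem _
  · obtain ⟨d, hd, hbd⟩ := I.round hb
    -- With `e` between `b` and some `d ∈ I`, the top splits as `e ∨ eᶜ`, where `e ∈ I` and `eᶜ` is
    -- in proximity to `bᶜ`.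
    obtain ⟨e, hbe, hed⟩ := hr.interpolate hbd
    exact (eq_top_iff_mem htop).mpr (mem_sup.mpr
      ⟨e, I.lower (hr.le hed) hd, eᶜ, hr.compl hbe, sup_compl_eq_top.ge⟩)

theorem isCompactRegular (htop : r ⊤ ⊤) : IsCompactRegular (RoundIdeal hr) where
  compact S hS := by
    obtain ⟨T, hT, h⟩ := (mem_sSup.mp ((eq_top_iff_mem htop).mp hS)).exists_finset
    exact ⟨T, hT, (eq_top_iff_mem htop).mpr h⟩
  regular I := by
    refine le_antisymm (le_def.mpr fun a ha => ?_) (sSup_le fun J hJ => RatherBelow.le hJ)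
    obtain ⟨b, hb, hab⟩ := I.round ha
    exact mem_sSup.mpr (.of_mem (principal_ratherBelow htop hb) hab)

end RoundIdeal

end RoundIdeals

/-! ### Representing a `dV`-space by round ideals of its regular open sets. -/

section DVSpace

variable {X : Type u} [TopologicalSpace X]

theorem SpecLE.refl (x : X) : SpecLE x x := fun _ _ h => h

theorem down_mono {U V : Set X} (h : U ⊆ V) : down U ⊆ down V :=
  fun _ ⟨y, hy, hle⟩ => ⟨y, h hy, hle⟩

theorem upInterior_mono {U V : Set X} (h : U ⊆ V) : upInterior U ⊆ upInterior V :=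
  fun _ hx y hy => h (hx y hy)

theorem IsOpen.subset_upInterior {U V : Set X} (hU : IsOpen U) (h : U ⊆ V) : U ⊆ upInterior V :=
  fun _ hx _ hy => h (hy U hU hx)

theorem upInterior_compl (U : Set X) : upInterior Uᶜ = (down U)ᶜ := by
  ext x
  simp only [upInterior, down, Set.mem_compl_iff, Set.mem_ofPred_eq]
  push Not
  exact forall_congr' fun _ => ⟨fun h hy hle => h hle hy, fun h hle hy => h hy hle⟩

theorem isOpen_perp (U : Set X) : IsOpen (perp U) := isClosed_closure.isOpen_compl

theorem IsRegularOpen.isOpen {U : Set X} (h : IsRegularOpen U) : IsOpen U := by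
  rw [← h]; exact isOpen_perp _

theorem perp_eq_coe_compl (U : TopologicalSpace.Opens X) :
    perp (U : Set X) = ((Uᶜ : TopologicalSpace.Opens X) : Set X) := by
  rw [TopologicalSpace.Opens.coe_compl_eq_interior_compl, interior_compl, perp]

theorem isRegularOpen_coe_iff (U : TopologicalSpace.Opens X) :
    IsRegularOpen (U : Set X) ↔ Heyting.IsRegular U := by
  rw [IsRegularOpen, perp_eq_coe_compl, perp_eq_coe_compl, SetLike.coe_set_eq]
  exact Iff.rfl

variable (X) in
/-- The Boolean algebra of regular open subsets of a space. -/
abbrev RegOpens : Type u := Heyting.Regular (TopologicalSpace.Opens X)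

/-- The underlying set of a regular open set. -/
def RegOpens.set (a : RegOpens X) : Set X := (a.val : Set X)

/-- The bundling of a regular open set. -/
def RegOpens.mk (U : Set X) (hU : IsRegularOpen U) : RegOpens X :=
  ⟨⟨U, hU.isOpen⟩, (isRegularOpen_coe_iff _).mp hU⟩

namespace RegOpens

theorem set_mk (U : Set X) (hU : IsRegularOpen U) : (mk U hU).set = U := rfl

theorem isRegularOpen (a : RegOpens X) : IsRegularOpen a.set :=
  (isRegularOpen_coe_iff a.val).mpr a.prop

theorem isOpen (a : RegOpens X) : IsOpen a.set := a.isRegularOpen.isOpen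

theorem mk_set (a : RegOpens X) : mk a.set a.isRegularOpen = a := rfl

theorem set_subset {a b : RegOpens X} : a.set ⊆ b.set ↔ a ≤ b := Iff.rfl

theorem set_compl (a : RegOpens X) : (aᶜ).set = perp a.set := (perp_eq_coe_compl a.val).symm

theorem set_top : (⊤ : RegOpens X).set = Set.univ := rfl

theorem set_bot : (⊥ : RegOpens X).set = ∅ := rfl

end RegOpens

namespace IsDVSpace

variable (hX : IsDVSpace X)
include hX

theorem subset_of_wayInside {U V : Set X} (hU : IsOpen U) (hV : IsRegularOpen V)
    (h : WayInside U V) : U ⊆ V := by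
  rw [← hX.orderRegular V hV]
  exact IsOpen.subset_upInterior hU (subset_closure.trans h)

theorem specLE_of_regularNhds_subset {x y : X} (h : regularNhds x ⊆ regularNhds y) :
    SpecLE x y := by
  intro U hU hx
  obtain ⟨V, hV, hxV, hVU⟩ := hX.basis.exists_subset_of_mem_open hx hU
  exact hVU (h ⟨hV, hxV⟩).2

/-- A point of the closure of `U` lies below a point that is contained in every regular open set
way outside of `U`. -/
theorem exists_specLE_of_mem_closure {U : Set X} (hU : IsRegularOpen U) {x : X}
    (hx : x ∈ closure U) :
    ∃ y, SpecLE x y ∧ ∀ V, IsRegularOpen V → WayInside U V → y ∈ V := by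
  have hc := hX.concordant x
  -- The filter generated by `U` and the regular neighbourhoods of `x`, proper since `x` is in the
  -- closure of `U`. Its round part keeps all of `regularNhds x`, which is concordant, so the point
  -- it defines lies above `x`.
  let F : Set (Set X) := {V | IsRegularOpen V ∧ ∃ G ∈ regularNhds x, G ∩ U ⊆ V}
  have hUF : U ∈ F := ⟨hU, _, hc.isROFilter.univ_mem, Set.inter_subset_right⟩
  have hGF : regularNhds x ⊆ F := fun G hG => ⟨hG.1, G, hG, Set.inter_subset_left⟩
  have hF : IsROFilter F :=
    { regular := fun V hV => hV.1
      univ_mem := hGF hc.isROFilter.univ_mem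
      inter_mem := by
        rintro V ⟨hV, G, hG, hGV⟩ W ⟨hW, H, hH, hHW⟩
        refine ⟨?_, G ∩ H, hc.isROFilter.inter_mem _ hG _ hH, ?_⟩
        · exact (RegOpens.mk V hV ⊓ RegOpens.mk W hW).isRegularOpen
        · exact fun z hz => ⟨hGV ⟨hz.1.1, hz.2⟩, hHW ⟨hz.1.2, hz.2⟩⟩
      mem_of_subset := fun V ⟨_, G, hG, hGV⟩ W hW hVW => ⟨hW, G, hG, hGV.trans hVW⟩
      empty_notMem := by
        rintro ⟨-, G, hG, hGU⟩
        obtain ⟨z, hz⟩ := mem_closure_iff.mp hx G hG.1.isOpen hG.2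
        exact hGU hz }
  obtain ⟨y, hy⟩ := hX.exists_point F hF
  refine ⟨y, hX.specLE_of_regularNhds_subset ?_, fun V hV hUV => ?_⟩
  · rw [← hy]
    intro G hG
    have hG' := hG
    rw [← hc.roundPart_eq] at hG'
    obtain ⟨-, H, hH, hHG⟩ := hG'
    exact ⟨hGF hG, H, hGF hH, hHG⟩
  · have : V ∈ roundPart F :=
      ⟨hF.mem_of_subset U hUF V hV (hX.subset_of_wayInside hU.isOpen hV hUV), U, hUF, hUV⟩
    rw [hy] at this
    exact this.2

/-- The way-inside relation of a `dV`-space is a proximity on its regular open sets. -/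
theorem isProximity : IsProximity (fun a b : RegOpens X => WayInside a.set b.set) where
  bot := by
    rw [WayInside, RegOpens.set_bot, closure_empty]
    exact Set.empty_subset _
  le h := RegOpens.set_subset.mp (hX.subset_of_wayInside (RegOpens.isOpen _)
    (RegOpens.isRegularOpen _) h)
  mono ha h hb := (closure_mono (RegOpens.set_subset.mpr ha)).trans
    (h.trans (down_mono (RegOpens.set_subset.mpr hb)))
  inf {a b c} hb hc x hx := by
    obtain ⟨y, hxy, hy⟩ := hX.exists_specLE_of_mem_closure a.isRegularOpen hx
    exact ⟨y, ⟨hy _ b.isRegularOpen hb, hy _ c.isRegularOpen hc⟩, hxy⟩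
  compl {a b} h := by
    rw [WayInside, RegOpens.set_compl, RegOpens.set_compl, ← Set.compl_subset_compl,
      ← upInterior_compl, perp, compl_compl]
    have hb := b.isRegularOpen
    rw [IsRegularOpen] at hb
    change upInterior (closure a.set) ⊆ perp (perp b.set)
    rw [hb]
    exact (upInterior_mono h).trans (hX.orderRegular _ b.isRegularOpen).subset
  interpolate {a b} h := by
    have hb : IsRegularClosed b.setᶜ := by
      rw [IsRegularClosed, interior_compl]
      have := b.isRegularOpen
      rw [IsRegularOpen, perp, perp] at this
      rw [← compl_compl (closure _), this]
    -- Order-normality separates `closure a` from the complement of `down b`. The interpolant is the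
    -- regularization of `P`, which is still disjoint from `Q`.
    obtain ⟨P, Q, hP, hQ, hPQ, haP, hbQ⟩ := hX.orderNormal (closure a.set) b.setᶜ
      isClosed_closure hb (by
        rw [upInterior_compl, Set.disjoint_compl_right_iff_subset]
        exact h)
    let P' : TopologicalSpace.Opens X := ⟨P, hP⟩
    have hPP : perp (perp P) = ((P'ᶜᶜ : TopologicalSpace.Opens X) : Set X) := by
      rw [← perp_eq_coe_compl, ← perp_eq_coe_compl]
      rfl
    have hW : IsRegularOpen (perp (perp P)) := by
      rw [hPP, isRegularOpen_coe_iff]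
      exact Heyting.isRegular_compl _
    have hPW : P ⊆ perp (perp P) := by
      rw [hPP]
      exact le_compl_compl (a := P')
    refine ⟨RegOpens.mk _ hW, haP.trans (down_mono hPW), ?_⟩
    rw [upInterior_compl] at hbQ
    have hQP : Q ⊆ perp P := fun z hz hzP =>
      closure_minimal hPQ.subset_compl_right hQ.isClosed_compl hzP hz
    have hWQ : Disjoint (perp (perp P)) Q :=
      Set.disjoint_left.mpr fun z hz hzQ => hz (subset_closure (hQP hzQ))
    exact (closure_minimal hWQ.subset_compl_right hQ.isClosed_compl).trans
      (Set.compl_subset_comm.mp hbQ)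

omit hX in
theorem wayInside_top : WayInside (⊤ : RegOpens X).set (⊤ : RegOpens X).set :=
  fun x _ => ⟨x, trivial, SpecLE.refl x⟩

/-- The round ideal of the regular open sets whose closure does not contain a point. -/
def pointIdeal (x : X) : RoundIdeal hX.isProximity where
  carrier := {a | x ∈ (aᶜ).set}
  bot_mem := by rw [Set.mem_ofPred_eq, compl_bot]; trivial
  sup_mem ha hb := by
    rw [Set.mem_ofPred_eq, compl_sup]; exact ⟨ha, hb⟩
  lower h hb := RegOpens.set_subset.mpr (compl_le_compl h) hb
  round {a} ha := by
    have : (aᶜ).set ∈ regularNhds x := ⟨RegOpens.isRegularOpen _, ha⟩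
    rw [← (hX.concordant x).roundPart_eq] at this
    obtain ⟨-, U, hU, h⟩ := this
    refine ⟨(RegOpens.mk U hU.1)ᶜ, ?_, ?_⟩
    · rw [Set.mem_ofPred_eq, compl_compl]
      exact hU.2
    · have := hX.isProximity.compl (a := RegOpens.mk U hU.1) h
      rwa [compl_compl] at this

theorem mem_pointIdeal {x : X} {a : RegOpens X} :
    a ∈ (hX.pointIdeal x).carrier ↔ x ∈ (aᶜ).set := Iff.rfl

/-- The points of a `dV`-space as points of `Ξ` of its frame of round ideals. -/
def toXi (x : X) : Xi (RoundIdeal hX.isProximity) :=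
  ⟨hX.pointIdeal x, fun h => by
    have := (RoundIdeal.eq_top_iff_mem wayInside_top).mp h
    rw [mem_pointIdeal, compl_top] at this
    exact this⟩

theorem toXi_injective : Function.Injective hX.toXi := by
  have key : ∀ x y : X, hX.pointIdeal x ≤ hX.pointIdeal y → SpecLE x y := by
    intro x y h
    refine hX.specLE_of_regularNhds_subset fun U hU => ⟨hU.1, ?_⟩
    have : (RegOpens.mk U hU.1)ᶜ ∈ (hX.pointIdeal x).carrier := by
      rw [mem_pointIdeal, compl_compl]; exact hU.2
    have := RoundIdeal.le_def.mp h this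
    rwa [mem_pointIdeal, compl_compl] at this
  intro x y h
  have h' : hX.pointIdeal x = hX.pointIdeal y := congrArg Subtype.val h
  have := hX.t0
  exact (inseparable_iff_forall_isOpen.mpr fun U hU =>
    ⟨key x y h'.le U hU, key y x h'.ge U hU⟩).eq

theorem toXi_surjective : Function.Surjective hX.toXi := by
  rintro ⟨J, hJ⟩
  -- Complementation turns the proper round ideal `J` into a proper filter equal to its own round
  -- part, to which the point axiom applies.
  let F : Set (Set X) := {U | ∃ a ∈ J.carrier, (aᶜ).set = U}
  have hFmk : ∀ {V} (hV : IsRegularOpen V), V ∈ F ↔ (RegOpens.mk V hV)ᶜ ∈ J.carrier := by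
    intro V hV
    constructor
    · rintro ⟨a, ha, rfl⟩
      rwa [RegOpens.mk_set, compl_compl]
    · intro h
      exact ⟨_, h, by rw [compl_compl, RegOpens.set_mk]⟩
  have hF : IsROFilter F :=
    { regular := by
        rintro _ ⟨a, -, rfl⟩
        exact RegOpens.isRegularOpen _
      univ_mem := ⟨⊥, J.bot_mem, by rw [compl_bot, RegOpens.set_top]⟩
      inter_mem := by
        rintro _ ⟨a, ha, rfl⟩ _ ⟨b, hb, rfl⟩
        exact ⟨a ⊔ b, J.sup_mem ha hb, by rw [compl_sup]; rfl⟩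
      mem_of_subset := by
        rintro _ ⟨a, ha, rfl⟩ V hV haV
        exact (hFmk hV).mpr (J.lower (compl_le_of_compl_le (RegOpens.set_subset.mp haV)) ha)
      empty_notMem := by
        rintro ⟨a, ha, h⟩
        have : aᶜ = ⊥ := le_bot_iff.mp (RegOpens.set_subset.mp h.subset)
        rw [compl_eq_bot] at this
        exact hJ ((RoundIdeal.eq_top_iff_mem wayInside_top).mpr (this ▸ ha)) }
  obtain ⟨x, hx⟩ := hX.exists_point F hF
  refine ⟨x, Subtype.ext (RoundIdeal.ext (Set.ext fun a => ?_))⟩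
  change x ∈ (aᶜ).set ↔ a ∈ J.carrier
  have h1 : x ∈ (aᶜ).set ↔ (aᶜ).set ∈ roundPart F := by
    rw [hx]
    exact ⟨fun h => ⟨RegOpens.isRegularOpen _, h⟩, fun h => h.2⟩
  rw [h1]
  constructor
  · rintro ⟨h, -⟩
    have := (hFmk (RegOpens.isRegularOpen _)).mp h
    rwa [RegOpens.mk_set, compl_compl] at this
  · intro ha
    obtain ⟨b, hb, hab⟩ := J.round ha
    exact ⟨⟨a, ha, rfl⟩, _, ⟨b, hb, rfl⟩, hX.isProximity.compl hab⟩

theorem preimage_toXi_cobasic (I : RoundIdeal hX.isProximity) :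
    hX.toXi ⁻¹' cobasic I = ⋃ a ∈ I.carrier, a.set := by
  ext x
  change I ⊔ hX.pointIdeal x = ⊤ ↔ _
  rw [RoundIdeal.eq_top_iff_mem wayInside_top, RoundIdeal.mem_sup]
  simp only [Set.mem_iUnion, exists_prop]
  constructor
  · rintro ⟨a, ha, b, hb, h⟩
    exact ⟨a, ha, RegOpens.set_subset.mpr
      (codisjoint_iff_compl_le_left.mp (codisjoint_iff.mpr (top_le_iff.mp h))) hb⟩
  · rintro ⟨a, ha, hx⟩
    exact ⟨a, ha, aᶜ, by rwa [mem_pointIdeal, compl_compl], sup_compl_eq_top.ge⟩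

/-- A `dV`-space is homeomorphic to `Ξ` of its frame of round ideals. -/
noncomputable def toXiHomeomorph : X ≃ₜ Xi (RoundIdeal hX.isProximity) :=
  (Equiv.ofBijective hX.toXi ⟨hX.toXi_injective, hX.toXi_surjective⟩).toHomeomorphOfContinuousOpen
    (by
      refine (isTopologicalBasis_cobasic
        (RoundIdeal.isCompactRegular wayInside_top)).continuous_iff.mpr ?_
      rintro _ ⟨I, rfl⟩
      change IsOpen (hX.toXi ⁻¹' cobasic I)
      rw [preimage_toXi_cobasic]
      exact isOpen_biUnion fun a _ => a.isOpen)
    (by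
      refine hX.basis.isOpenMap_iff.mpr fun U hU => ?_
      -- Concordance of neighbourhood filters makes `U` the union of the regular open sets way
      -- inside it, so its image is basic.
      have hU' : hX.toXi '' U =
          cobasic (RoundIdeal.principal hX.isProximity (RegOpens.mk U hU)) := by
        rw [← Set.image_preimage_eq (cobasic _) hX.toXi_surjective, preimage_toXi_cobasic]
        congr 1
        ext x
        simp only [Set.mem_iUnion, exists_prop, RoundIdeal.mem_principal, RegOpens.set_mk]
        constructor
        · intro hx
          have hU' : U ∈ regularNhds x := ⟨hU, hx⟩
          rw [← (hX.concordant x).roundPart_eq] at hU'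
          obtain ⟨-, V, hV, hVU⟩ := hU'
          exact ⟨RegOpens.mk V hV.1, hVU, hV.2⟩
        · rintro ⟨a, ha, hx⟩
          exact hX.subset_of_wayInside a.isOpen hU ha hx
      change IsOpen (hX.toXi '' U)
      rw [hU']
      exact isOpen_cobasic (RoundIdeal.isCompactRegular wayInside_top) _)

end IsDVSpace

end DVSpace

/-! ### Transport along order isomorphisms and homeomorphisms. -/

section Transport

theorem IsCompactRegular.of_orderIso {L M : Type u} [Order.Frame L] [Order.Frame M]
    (hL : IsCompactRegular L) (e : L ≃o M) : IsCompactRegular M where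
  compact S hS := by
    classical
    obtain ⟨T, hT, h⟩ := hL.compact (e.symm '' S) (by
      rw [sSup_image, ← e.symm.map_sSup, hS, e.symm.map_top])
    refine ⟨T.image e, ?_, ?_⟩
    · rw [Finset.coe_image]
      rintro _ ⟨a, ha, rfl⟩
      obtain ⟨s, hs, hsa⟩ := hT ha
      rwa [← hsa, e.apply_symm_apply]
    · rw [Finset.coe_image, sSup_image, ← e.map_sSup, h, e.map_top]
  regular a := by
    refine le_antisymm ?_ (sSup_le fun b hb => RatherBelow.le hb)
    suffices h : e (e.symm a) ≤ sSup {b | RatherBelow b a} by rwa [e.apply_symm_apply] at h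
    rw [hL.regular (e.symm a), e.map_sSup]
    refine iSup₂_le fun b hb => le_sSup ?_
    obtain ⟨c, hbc, hc⟩ := ratherBelow_iff.mp hb
    have h1 : e b ⊓ e c = ⊥ := by rw [← e.map_inf, hbc, e.map_bot]
    have h2 : a ⊔ e c = ⊤ := by rw [← e.apply_symm_apply a, ← e.map_sup, hc, e.map_top]
    exact ratherBelow_iff.mpr ⟨e c, h1, h2⟩

theorem IsCompactRegular.isCompactRegularFrameOrder {L P : Type u} [Order.Frame L]
    [PartialOrder P] (hL : IsCompactRegular L) (e : L ≃o P) : IsCompactRegularFrameOrder P := by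
  let _ : CompleteLattice P := e.toGaloisInsertion.liftCompleteLattice
  let F : Order.Frame P := Order.Frame.ofMinimalAxioms
    { inf_sSup_le_iSup_inf := fun a S => by
        rw [← e.symm.le_iff_le, e.symm.map_inf, e.symm.map_sSup, inf_iSup₂_eq]
        refine iSup₂_le fun b hb => ?_
        rw [← e.symm.map_inf, e.symm.le_iff_le]
        exact le_iSup₂ (f := fun b (_ : b ∈ S) => a ⊓ b) b hb }
  exact ⟨F, fun _ _ => Iff.rfl, hL.of_orderIso e⟩

/-- Conjugation of a frame homomorphism by order isomorphisms. -/
def frameHomConj {L M P Q : Type u} [Order.Frame L] [Order.Frame M] [Order.Frame P]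
    [Order.Frame Q] (eP : L ≃o P) (eQ : M ≃o Q) (h : FrameHom L M) : FrameHom P Q :=
  ((eQ : FrameHom M Q).comp h).comp (eP.symm : FrameHom P L)

variable {X Y : Type u} [TopologicalSpace X] [TopologicalSpace Y]

theorem specLE_homeomorph (k : X ≃ₜ Y) {x y : X} : SpecLE (k x) (k y) ↔ SpecLE x y := by
  refine ⟨fun h => ?_, fun h => h.map k.continuous⟩
  simpa using h.map k.symm.continuous

theorem isDVMap_homeomorph (k : X ≃ₜ Y) : IsDVMap k where
  continuous := k.continuous
  weaklyDense x y h := ⟨k.symm y, by rwa [← specLE_homeomorph k, k.apply_symm_apply],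
    by rw [k.apply_symm_apply]; exact SpecLE.refl y⟩

theorem preimage_down (k : X ≃ₜ Y) (U : Set Y) : k ⁻¹' down U = down (k ⁻¹' U) := by
  ext x
  constructor
  · rintro ⟨y, hy, h⟩
    exact ⟨k.symm y, by rwa [Set.mem_preimage, k.apply_symm_apply],
      by rwa [← specLE_homeomorph k, k.apply_symm_apply]⟩
  · rintro ⟨y, hy, h⟩
    exact ⟨k y, hy, (specLE_homeomorph k).mpr h⟩

theorem preimage_upInterior (k : X ≃ₜ Y) (U : Set Y) :
    k ⁻¹' upInterior U = upInterior (k ⁻¹' U) := by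
  rw [← compl_compl U, upInterior_compl, Set.preimage_compl, preimage_down, Set.preimage_compl,
    Set.preimage_compl, upInterior_compl, Set.preimage_compl]

theorem IsOrderRegularOpen.preimage (k : X ≃ₜ Y) {U : Set Y} (hU : IsOrderRegularOpen U) :
    IsOrderRegularOpen (k ⁻¹' U) := by
  rw [IsOrderRegularOpen, ← preimage_down, ← preimage_upInterior, hU]

theorem IsWellRounded.preimage (k : X ≃ₜ Y) {U : Set Y} (hU : IsWellRounded U) :
    IsWellRounded (k ⁻¹' U) where
  isOpen := hU.isOpen.preimage k.continuous
  separation B hB h := by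
    obtain ⟨V, W, hV, hW, hVW, hBV, hWU⟩ := hU.separation (k.symm ⁻¹' B)
      (hB.preimage k.symm.continuous) (by
        rw [← preimage_down] at h
        intro y hy
        simpa using h hy)
    refine ⟨k ⁻¹' V, k ⁻¹' W, hV.preimage k.continuous, hW.preimage k.continuous,
      hVW.preimage k, ?_, ?_⟩
    · rw [← preimage_down]
      intro x hx
      exact hBV (by rwa [Set.mem_preimage, k.symm_apply_apply])
    · rw [← preimage_down, ← Set.preimage_compl]
      exact Set.preimage_mono hWU

/-- Inverse image under a homeomorphism is an isomorphism between the posets of well-rounded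
order-regular open sets. -/
def woroCongr (k : X ≃ₜ Y) : WORO Y ≃o WORO X where
  toFun U := ⟨k ⁻¹' U.1, U.2.1.preimage k, U.2.2.preimage k⟩
  invFun U := ⟨k.symm ⁻¹' U.1, U.2.1.preimage k.symm, U.2.2.preimage k.symm⟩
  left_inv U := Subtype.ext (by simp [← Set.preimage_comp])
  right_inv U := Subtype.ext (by simp [← Set.preimage_comp])
  map_rel_iff' := Set.preimage_subset_preimage_iff (by simp [k.surjective.range_eq])

end Transport

/-! ### The functors and the dual equivalence. -/

section Functors

/-- The frame of round ideals of regular open subsets of a `dV`-space. -/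
abbrev DVS.Ideals (X : DVS.{u}) : Type u := RoundIdeal X.isDVSpace.isProximity

theorem DVS.isCompactRegular_ideals (X : DVS.{u}) : IsCompactRegular X.Ideals :=
  RoundIdeal.isCompactRegular IsDVSpace.wayInside_top

/-- Round ideals of regular open sets correspond to well-rounded order-regular open sets. -/
noncomputable def DVS.idealsIso (X : DVS.{u}) : X.Ideals ≃o WORO X :=
  (cobasicIso X.isCompactRegular_ideals).trans (woroCongr X.isDVSpace.toXiHomeomorph)

theorem DVS.coe_idealsIso (X : DVS.{u}) (I : X.Ideals) :
    (X.idealsIso I).1 = X.isDVSpace.toXiHomeomorph ⁻¹' cobasic I := rfl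

theorem xiLifts : XiLifts.{u} where
  obj L := isDVSpace_xi L.property
  map {L M} h := isDVMap_xiMap L.property M.property (KRFrm.frameHom h)

theorem DVS.isCompactRegularFrameOrder_woro (X : DVS.{u}) : IsCompactRegularFrameOrder (WORO X) :=
  X.isCompactRegular_ideals.isCompactRegularFrameOrder X.idealsIso

theorem woroLifts : WOROLifts.{u} where
  obj := DVS.isCompactRegularFrameOrder_woro
  map {X Y} f := by
    let kX := X.isDVSpace.toXiHomeomorph
    let kY := Y.isDVSpace.toXiHomeomorph
    -- Conjugating `f` by the representing homeomorphisms gives a `dV`-map between spaces of round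
    -- ideals, hence a frame homomorphism, which is carried back to `WORO`.
    obtain ⟨h, hh⟩ := exists_xiMap_eq Y.isCompactRegular_ideals X.isCompactRegular_ideals
      ((isDVMap_homeomorph kY).comp (f.isDVMap.comp (isDVMap_homeomorph kX.symm)))
    refine ⟨ObjectProperty.homMk (@Frm.ofHom _ _ (_) (_) (@frameHomConj _ _ (WORO Y) (WORO X) _ _
      Y.isCompactRegularFrameOrder_woro.frame X.isCompactRegularFrameOrder_woro.frame
      Y.idealsIso X.idealsIso h)), fun U => ?_⟩
    obtain ⟨a, rfl⟩ := Y.idealsIso.surjective U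
    change (X.idealsIso (h (Y.idealsIso.symm (Y.idealsIso a)))).1 = _
    rw [OrderIso.symm_apply_apply, DVS.coe_idealsIso, DVS.coe_idealsIso,
      ← preimage_xiMap_cobasic Y.isCompactRegular_ideals X.isCompactRegular_ideals, hh]
    ext x
    simp [kX, kY]

/-- Homeomorphic `dV`-spaces are isomorphic. -/
def DVS.isoOfHomeomorph {X Y : DVS.{u}} (k : X ≃ₜ Y) : X ≅ Y where
  hom := ⟨k, isDVMap_homeomorph k⟩
  inv := ⟨k.symm, isDVMap_homeomorph k.symm⟩
  hom_inv_id := DVS.Hom.ext (funext k.symm_apply_apply)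
  inv_hom_id := DVS.Hom.ext (funext k.apply_symm_apply)

/-- Isomorphic `dV`-spaces are homeomorphic. -/
def DVS.homeomorphOfIso {X Y : DVS.{u}} (e : X ≅ Y) : X ≃ₜ Y where
  toFun := e.hom.toFun
  invFun := e.inv.toFun
  left_inv := congrFun (congrArg DVS.Hom.toFun e.hom_inv_id)
  right_inv := congrFun (congrArg DVS.Hom.toFun e.inv_hom_id)
  continuous_toFun := e.hom.isDVMap.continuous
  continuous_invFun := e.inv.isDVMap.continuous

instance faithful_xiFunctor (hΞ : XiLifts.{u}) : (xiFunctor hΞ).Faithful where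
  map_injective {L M h k} H := by
    apply Quiver.Hom.unop_inj
    apply ObjectProperty.hom_ext
    apply ConcreteCategory.hom_injective
    exact xiMap_injective (congrArg DVS.Hom.toFun H)

instance full_xiFunctor (hΞ : XiLifts.{u}) : (xiFunctor hΞ).Full where
  map_surjective {L M} f := by
    obtain ⟨h, hh⟩ := exists_xiMap_eq M.unop.property L.unop.property f.isDVMap
    exact ⟨(ObjectProperty.homMk (Frm.ofHom h)).op, DVS.Hom.ext hh⟩

instance essSurj_xiFunctor (hΞ : XiLifts.{u}) : (xiFunctor hΞ).EssSurj where
  mem_essImage X :=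
    ⟨.op ⟨Frm.of X.Ideals, X.isCompactRegular_ideals⟩,
      ⟨DVS.isoOfHomeomorph X.isDVSpace.toXiHomeomorph.symm⟩⟩

instance isEquivalence_rightOp_xiFunctor (hΞ : XiLifts.{u}) :
    (xiFunctor hΞ).rightOp.IsEquivalence where
  essSurj := ⟨fun X => by
    obtain ⟨L, ⟨e⟩⟩ := (essSurj_xiFunctor hΞ).mem_essImage X.unop
    exact ⟨L.unop, ⟨e.symm.op⟩⟩⟩

/-- Compact regular frames are naturally isomorphic to the frames of well-rounded order-regular
open sets of their spaces. -/
noncomputable def xiWoroIso (hΞ : XiLifts.{u}) (hW : WOROLifts.{u}) :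
    (xiFunctor hΞ).rightOp ⋙ woroFunctor hW ≅ 𝟭 KRFrm.{u} :=
  (NatIso.ofComponents
    (fun L => ObjectProperty.isoMk _ (@Frm.Iso.mk L.obj
      (woroFrame hW.obj ⟨Xi L.obj, hΞ.obj L⟩).obj (cobasicIso L.property)))
    (fun {L M} h => by
      apply ObjectProperty.hom_ext
      apply Frm.ext
      intro a
      apply Subtype.ext
      refine (preimage_xiMap_cobasic L.property M.property (KRFrm.frameHom h) a).symm.trans ?_
      exact ((hW.map ((xiFunctor hΞ).map h.op)).choose_spec
        (cobasicIso L.property a)).symm)).symm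

/-- The dual equivalence between `dV`-spaces and compact regular frames. -/
noncomputable def dualEquivalence (hΞ : XiLifts.{u}) (hW : WOROLifts.{u}) :
    DVS.{u}ᵒᵖ ≌ KRFrm.{u} :=
  -- The chosen abstract quasi-inverse is replaced by `woroFunctor hW`, so that both functors of the
  -- equivalence are the prescribed ones by definition.
  (xiFunctor hΞ).rightOp.asEquivalence.symm.changeFunctor
    ((Iso.isoInverseComp (G := (xiFunctor hΞ).rightOp.asEquivalence) (xiWoroIso hΞ hW) ≪≫
      Functor.rightUnitor _).symm)

end Functors

end DeVries

theorem theorem6p2 :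
    ∃ (hΞ : DeVries.XiLifts.{u}) (hW : DeVries.WOROLifts.{u}),
      (∀ L : DeVries.KRFrm.{u}, Nonempty (L.obj ≃o DeVries.WORO (DeVries.Xi L.obj))) ∧
      (∀ X : DeVries.DVS.{u},
        Nonempty (X ≃ₜ DeVries.Xi (DeVries.woroFrame hW.obj X).obj)) ∧
      ∃ e : DeVries.DVS.{u}ᵒᵖ ≌ DeVries.KRFrm.{u},
        e.functor = DeVries.woroFunctor hW ∧
          e.inverse = (DeVries.xiFunctor hΞ).rightOp := by
  refine ⟨DeVries.xiLifts, DeVries.woroLifts, fun L => ⟨DeVries.cobasicIso L.property⟩,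
    fun X => ?_, DeVries.dualEquivalence DeVries.xiLifts DeVries.woroLifts, rfl, rfl⟩
  exact ⟨(DeVries.DVS.homeomorphOfIso
    ((DeVries.dualEquivalence DeVries.xiLifts DeVries.woroLifts).unitIso.app (.op X)).unop).symm⟩
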